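/- Let $\Omega\subset\mathbb R$ be an interval, let $N\ge 1$, let $x_1,\dots,x_N\in\mathbb R$ be pairwise distinct, and let $\mu_N=\frac1N\sum_{i=1}^N\delta_{x_i}$. Let $K$ be the set of probability measures on $\Omega$ that have a Lebesgue density bounded by $1$. Let $\sigma_N$ be a projection of $\mu_N$ onto $K$ for the quadratic Wasserstein distance $W_2$, that is, a minimizer of $\sigma\mapsto W_2^2(\mu_N,\sigma)$ over $K$, and let $T:\Omega\to\mathbb R$ be an optimal transport map from $\sigma_N$ to $\mu_N$ for the quadratic cost. Define the Laguerre cells and their barycenters by $$L_i=T^{-1}(\{x_i\}),\qquad \beta_i=N\int_{L_i}x\,d\sigma_N(x),\qquad 1\le i\le N.$$ Then for every $i$ the cell $L_i$ coincides, up to a $\sigma_N$-null set, with an interval $[a_i,b_i]$ of length $b_i-a_i=1/N$; the restriction of $\sigma_N$ to $L_i$ is Lebesgue measure on $[a_i,b_i]$; and $\beta_i=\frac{a_i+b_i}2$ is its midpoint. Moreover, with $\varepsilon=1/N$, $$\frac1{\varepsilon^2}\,W_2^2\Big(\sigma_N,\frac1N\sum_{i=1}^N\delta_{\beta_i}\Big)\le\frac1{12}.$$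 -/

import Mathlib

open MeasureTheory Set
open scoped ENNReal

namespace CrowdMotion

noncomputable section

/-- Transport plans (couplings) between two measures on the line. -/
def couplings (μ ν : Measure ℝ) : Set (Measure (ℝ × ℝ)) :=
  {π | π.map Prod.fst = μ ∧ π.map Prod.snd = ν}

/-- The quadratic Wasserstein distance, with values in `[0, ∞]`. -/
def W2 (μ ν : Measure ℝ) : ℝ≥0∞ :=
  (⨅ π ∈ couplings μ ν, ∫⁻ p, edist p.1 p.2 ^ 2 ∂π) ^ (1 / 2 : ℝ)

/-- The atomic measure `(1/N) ∑ i, δ_{x i}`. -/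
def empirical {N : ℕ} (x : Fin N → ℝ) : Measure ℝ :=
  (N : ℝ≥0∞)⁻¹ • ∑ i, Measure.dirac (x i)

/-- Probability measures carried by `Ω` whose Lebesgue density is at most `1`; as an inequality
between measures, this is `ρ ≤ volume`. -/
def K (Ω : Set ℝ) : Set (Measure ℝ) :=
  {ρ | IsProbabilityMeasure ρ ∧ ρ Ωᶜ = 0 ∧ ρ ≤ volume}

/-- `σ` is a `W2`-projection of `μ` onto `K Ω`: a minimizer over `K Ω` of the squared distance
to `μ`. -/
def IsProjection (Ω : Set ℝ) (μ σ : Measure ℝ) : Prop :=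
  σ ∈ K Ω ∧ ∀ ρ ∈ K Ω, W2 μ σ ^ 2 ≤ W2 μ ρ ^ 2

/-- `T` is an optimal transport map from `σ` to `μ` for the quadratic cost. -/
def IsOptimalMap (σ μ : Measure ℝ) (T : ℝ → ℝ) : Prop :=
  Measurable T ∧ σ.map T = μ ∧ ∫⁻ y, edist y (T y) ^ 2 ∂σ = W2 σ μ ^ 2

/-- The part of `Ω` that is sent to the particle `x i`. Only the values of `T` on `Ω` matter. -/
def cell (Ω : Set ℝ) (T : ℝ → ℝ) {N : ℕ} (x : Fin N → ℝ) (i : Fin N) : Set ℝ :=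
  Ω ∩ T ⁻¹' {x i}

/-- The barycenter of the `i`-th cell, a cell of mass `1/N`. -/
def bary (Ω : Set ℝ) (σ : Measure ℝ) (T : ℝ → ℝ) {N : ℕ} (x : Fin N → ℝ) (i : Fin N) : ℝ :=
  N * ∫ y in cell Ω T x i, y ∂σ

end

end CrowdMotion

namespace CrowdMotion

/-! Any tuple of measures of mass `1/N` on `Ω` with sum at most Lebesgue gives a competitor in `K Ω`
and a coupling with the atoms. Minimality of `σ` thus makes its cells an optimal partition
(`isOptimalPartition_cells`), and two exchange arguments, both through `bathtub`, give their shape.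
Between two cells, the difference of the quadratic costs is affine, so a point separates them
(`separated`). Between a cell and the unused room `v` in `Ω`, moving mass towards `x i` would lower
the cost, so the cell lies in a ball without room (`saturated`). Intersecting `Ω`, this ball and the
half-lines gives an interval that carries the cell and is null for the other cells and for `v`;
there the cell is Lebesgue measure, and its mass gives the length. Sending each cell to its midpoint
costs `ε ^ 3 / 12`; there are `1 / ε` cells. -/

lemma W2_sq (μ ν : Measure ℝ) :
    W2 μ ν ^ 2 = ⨅ π ∈ couplings μ ν, ∫⁻ p, edist p.1 p.2 ^ 2 ∂π := by
  rw [W2, ← ENNReal.rpow_natCast, ← ENNReal.rpow_mul]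
  norm_num

lemma W2_sq_le_of_coupling {μ ν : Measure ℝ} {π : Measure (ℝ × ℝ)} (h : π ∈ couplings μ ν) :
    W2 μ ν ^ 2 ≤ ∫⁻ p, edist p.1 p.2 ^ 2 ∂π := by
  rw [W2_sq]
  exact iInf₂_le π h

/-- Needed because projections measure from the atoms and optimal maps towards them. -/
lemma W2_sq_le_swap (μ ν : Measure ℝ) : W2 μ ν ^ 2 ≤ W2 ν μ ^ 2 := by
  rw [W2_sq ν μ]
  refine le_iInf₂ fun π hπ => ?_
  have h : π.map Prod.swap ∈ couplings μ ν := by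
    refine ⟨?_, ?_⟩
    · rw [Measure.map_map measurable_fst measurable_swap]
      exact hπ.2
    · rw [Measure.map_map measurable_snd measurable_swap]
      exact hπ.1
  refine (W2_sq_le_of_coupling h).trans (le_of_eq ?_)
  rw [lintegral_map (by fun_prop) measurable_swap]
  simp [edist_comm]

lemma map_finset_sum {α β ι : Type*} [MeasurableSpace α] [MeasurableSpace β] (t : Finset ι)
    (m : ι → Measure α) {f : α → β} (hf : Measurable f) :
    (∑ i ∈ t, m i).map f = ∑ i ∈ t, (m i).map f := by
  classical
  induction t using Finset.induction_on with
  | empty => simp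
  | insert a t ha ih => rw [Finset.sum_insert ha, Measure.map_add _ _ hf, ih, Finset.sum_insert ha]

/-- Sending the `k`-th piece of a measure, of mass `1/N`, to the `k`-th atom is a transport. -/
lemma W2_sq_sum_le {N : ℕ} (z : Fin N → ℝ) (s : Fin N → Measure ℝ)
    (hs : ∀ k, s k univ = (N : ℝ≥0∞)⁻¹) :
    W2 (∑ k, s k) (empirical z) ^ 2 ≤ ∑ k, ∫⁻ y, edist y (z k) ^ 2 ∂(s k) := by
  have hm : ∀ k, Measurable fun y : ℝ => (y, z k) := fun k => by fun_prop
  have h : (∑ k, (s k).map fun y => (y, z k)) ∈ couplings (∑ k, s k) (empirical z) := by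
    refine ⟨?_, ?_⟩
    · rw [map_finset_sum _ _ measurable_fst]
      refine Finset.sum_congr rfl fun k _ => ?_
      rw [Measure.map_map measurable_fst (hm k)]
      exact Measure.map_id
    · rw [map_finset_sum _ _ measurable_snd, empirical, Finset.smul_sum]
      refine Finset.sum_congr rfl fun k _ => ?_
      rw [Measure.map_map measurable_snd (hm k), ← hs k]
      exact Measure.map_const _ _
  refine (W2_sq_le_of_coupling h).trans (le_of_eq ?_)
  rw [lintegral_finsetSum_measure]
  refine Finset.sum_congr rfl fun k _ => ?_
  rw [lintegral_map (by fun_prop) (hm k)]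

lemma edist_sq_eq_ofReal (y z : ℝ) : edist y z ^ 2 = ENNReal.ofReal ((y - z) ^ 2) := by
  rw [edist_dist, Real.dist_eq, ← ENNReal.ofReal_pow (abs_nonneg _), sq_abs]

/-! ### Exchange principle and facts on the line -/

/-- The bathtub principle: mass of `s` above the level `t` cannot be moved below the level, into the
room left by `r`, without strictly decreasing the integral of `f`. -/
lemma bathtub {α : Type*} [MeasurableSpace α] (s r : Measure α) [IsFiniteMeasure s]
    {f : α → ℝ} {B : Set α} {t : ℝ} (hB : MeasurableSet B)
    (hle : ∀ y ∈ B, f y ≤ t) (hgt : ∀ y ∈ Bᶜ, t < f y)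
    (hmass : s B + r B = s univ) (hs : Integrable f s) (hr : IntegrableOn f B r)
    (hopt : ∫ y, f y ∂s ≤ ∫ y in B, f y ∂s + ∫ y in B, f y ∂r) :
    s Bᶜ = 0 ∧ r B = 0 := by
  have hrs : r B = s Bᶜ := by
    have := measure_add_measure_compl (μ := s) hB
    rw [← this] at hmass
    exact (ENNReal.add_right_inj (measure_ne_top s B)).1 hmass
  suffices s Bᶜ = 0 from ⟨this, hrs.trans this⟩
  have hrfin : r B ≠ ∞ := hrs ▸ measure_ne_top s _
  have h1 : ∫ y in Bᶜ, f y ∂s ≤ ∫ y in B, f y ∂r := by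
    have := integral_add_compl hB hs
    linarith
  have h2 : ∫ y in B, f y ∂r ≤ t * r.real B := by
    have := setIntegral_mono_on hr (integrableOn_const hrfin (C := t)) hB hle
    simpa [mul_comm] using this
  -- The mass removed from `Bᶜ` equals the mass `r B` added at level at most `t`. Since `f > t` on
  -- `Bᶜ`, this sign forces `s Bᶜ = 0`.
  have h3 : ∫ y in Bᶜ, (f y - t) ∂s ≤ 0 := by
    rw [integral_sub hs.integrableOn (integrable_const _)]
    have : r.real B = s.real Bᶜ := by simp [Measure.real, hrs]
    rw [this] at h2
    simp only [integral_const, smul_eq_mul, measureReal_restrict_apply_univ]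
    linarith
  by_contra hne
  have hpos : 0 < ∫ y in Bᶜ, (f y - t) ∂s := by
    rw [setIntegral_pos_iff_support_of_nonneg_ae]
    · have : Function.support (fun y => f y - t) ∩ Bᶜ = Bᶜ :=
        inter_eq_right.2 fun y hy => (sub_pos.2 (hgt y hy)).ne'
      rw [this]
      exact pos_iff_ne_zero.2 hne
    · exact (ae_restrict_mem hB.compl).mono fun y hy => (sub_pos.2 (hgt y hy)).le
    · exact hs.integrableOn.sub (integrable_const _)
  exact absurd h3 hpos.not_ge

/-- A measure without atoms attains on the half-lines every value between two of its values. -/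
lemma exists_measure_Iic_eq (ν : Measure ℝ) [NullSingletonClass ν] {m : ℝ≥0∞} {t₀ t₁ : ℝ}
    (h0 : ν (Iic t₀) ≤ m) (h1 : m ≤ ν (Iic t₁)) (hfin : ν (Iic t₁) ≠ ∞) :
    ∃ t, ν (Iic t) = m := by
  rcases le_total t₁ t₀ with h | h
  · exact ⟨t₁, le_antisymm ((measure_mono (Iic_subset_Iic.2 h)).trans h0) h1⟩
  have : Fact (ν (Iic t₁) < ∞) := ⟨hfin.lt_top⟩
  -- `ν` may be infinite; only its part below `t₁` matters. Continuity of its distribution function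
  -- then allows the intermediate value theorem.
  set κ := ν.restrict (Iic t₁)
  have hκ : ∀ t ≤ t₁, κ (Iic t) = ν (Iic t) := fun t ht => by
    rw [Measure.restrict_apply measurableSet_Iic, inter_eq_left.2 (Iic_subset_Iic.2 ht)]
  have hcont : Continuous fun t => ∫ _ in Iic t, (1 : ℝ) ∂κ := by
    have hi : Integrable (fun _ => (1 : ℝ)) κ := integrable_const _
    have : (fun t => ∫ _ in Iic t, (1 : ℝ) ∂κ) =
        fun t => ∫ _ in Iic t₀, (1 : ℝ) ∂κ + ∫ _ in t₀..t, (1 : ℝ) ∂κ := by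
      ext t
      rw [← intervalIntegral.integral_Iic_sub_Iic hi.integrableOn hi.integrableOn]
      ring
    rw [this]
    exact continuous_const.add
      (intervalIntegral.continuous_primitive (fun _ _ => hi.intervalIntegrable) _)
  have hm : m ≠ ∞ := ne_top_of_le_ne_top hfin h1
  have hval : ∀ t, ∫ _ in Iic t, (1 : ℝ) ∂κ = (κ (Iic t)).toReal := fun t => by
    simp [Measure.real]
  obtain ⟨t, ht, hteq⟩ := intermediate_value_Icc h hcont.continuousOn
    (show m.toReal ∈ Icc _ _ by
      simp only [hval]
      rw [hκ _ h, hκ _ le_rfl]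
      exact ⟨ENNReal.toReal_mono hm h0, ENNReal.toReal_mono hfin h1⟩)
  refine ⟨t, ?_⟩
  rw [← hκ t ht.2]
  simp only [hval] at hteq
  exact (ENNReal.toReal_eq_toReal_iff' (measure_ne_top _ _) hm).1 hteq

/-- Finite length bounds `C`, which then lies between the open and the closed interval from its
infimum to its supremum. -/
lemma exists_Icc_of_ordConnected {C : Set ℝ} (hC : C.OrdConnected) {ℓ : ℝ} (hℓ : 0 < ℓ)
    (hvol : volume C = ENNReal.ofReal ℓ) :
    ∃ a b : ℝ, b - a = ℓ ∧ C =ᵐ[volume] Icc a b := by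
  have hdist : ∀ p ∈ C, ∀ q ∈ C, q ≤ p + ℓ := fun p hp q hq => by
    rcases le_total q p with h | h
    · linarith
    have := measure_mono (μ := volume) (hC.out hp hq)
    rw [hvol, Real.volume_Icc] at this
    have := (ENNReal.ofReal_le_ofReal_iff hℓ.le).1 this
    linarith
  have hne : C.Nonempty := by
    by_contra h
    rw [not_nonempty_iff_eq_empty.1 h, measure_empty] at hvol
    have := ENNReal.ofReal_pos.2 hℓ
    exact this.ne hvol
  obtain ⟨p, hp⟩ := hne
  have hba : BddAbove C := ⟨p + ℓ, fun q hq => hdist p hp q hq⟩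
  have hbb : BddBelow C := ⟨p - ℓ, fun q hq => by have := hdist q hq p hp; linarith⟩
  have hsub : C ⊆ Icc (sInf C) (sSup C) := fun q hq => ⟨csInf_le hbb hq, le_csSup hba hq⟩
  have hsup : Ioo (sInf C) (sSup C) ⊆ C := fun q hq => by
    obtain ⟨u, hu, huq⟩ := exists_lt_of_csInf_lt ⟨p, hp⟩ hq.1
    obtain ⟨v, hv, hqv⟩ := exists_lt_of_lt_csSup ⟨p, hp⟩ hq.2
    exact hC.out hu hv ⟨huq.le, hqv.le⟩
  have hae : C =ᵐ[volume] Icc (sInf C) (sSup C) :=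
    hsub.eventuallyLE.antisymm (Ioo_ae_eq_Icc.symm.le.trans hsup.eventuallyLE)
  refine ⟨_, _, ?_, hae⟩
  rw [measure_congr hae, Real.volume_Icc] at hvol
  have hle : 0 ≤ sSup C - sInf C := sub_nonneg.2 ((csInf_le hbb hp).trans (le_csSup hba hp))
  exact (ENNReal.ofReal_eq_ofReal_iff hle hℓ.le).1 hvol

/-! ### Optimal partitions -/

/-- A measure on `Ω` below Lebesgue, cut into `N` pieces of mass `1/N`. -/
structure IsPartition (Ω : Set ℝ) {N : ℕ} (s : Fin N → Measure ℝ) : Prop where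
  mass : ∀ k, s k univ = (N : ℝ≥0∞)⁻¹
  null : ∀ k, s k Ωᶜ = 0
  le_volume : ∑ k, s k ≤ volume

/-- The partition `s` minimizes the cost of sending its `k`-th piece to `x k`. -/
structure IsOptimalPartition (Ω : Set ℝ) {N : ℕ} (x : Fin N → ℝ) (s : Fin N → Measure ℝ) : Prop
    extends IsPartition Ω s where
  integrable : ∀ k z, Integrable (fun y => (y - z) ^ 2) (s k)
  -- Integrability of the competitor matters: a Bochner integral of infinite cost would be `0`.
  le : ∀ r : Fin N → Measure ℝ, IsPartition Ω r →
    (∀ k, Integrable (fun y => (y - x k) ^ 2) (r k)) →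
    ∑ k, ∫ y, (y - x k) ^ 2 ∂(s k) ≤ ∑ k, ∫ y, (y - x k) ^ 2 ∂(r k)

section Optimality

variable {Ω : Set ℝ} {N : ℕ} {x : Fin N → ℝ} {s : Fin N → Measure ℝ}

lemma IsPartition.isFiniteMeasure (h : IsPartition Ω s) (k : Fin N) : IsFiniteMeasure (s k) :=
  ⟨by
    rw [h.mass, ENNReal.inv_lt_top]
    exact_mod_cast k.pos⟩

lemma IsPartition.piece_le (h : IsPartition Ω s) (k : Fin N) : s k ≤ volume :=
  (Finset.single_le_sum (fun j _ => Measure.zero_le (s j)) (Finset.mem_univ k)).trans h.le_volume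

lemma nullSingletonClass_of_le_volume {r : Measure ℝ} (h : r ≤ volume) : NullSingletonClass r :=
  ⟨fun y => le_antisymm ((h {y}).trans (by simp)) zero_le⟩

lemma sum_eq_add_add {M : Type*} [AddCommMonoid M] {i j : Fin N} (hij : i ≠ j) (F : Fin N → M) :
    ∑ k, F k = F i + (F j + ∑ k ∈ (Finset.univ.erase i).erase j, F k) := by
  rw [Finset.add_sum_erase _ _ (by simp [hij.symm]), Finset.add_sum_erase _ _ (by simp)]

/-- The cells of two particles are separated by a point. -/
lemma IsOptimalPartition.separated (h : IsOptimalPartition Ω x s) {i j : Fin N}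
    (hij : x i < x j) : ∃ t, s i (Iic t)ᶜ = 0 ∧ s j (Iic t) = 0 := by
  have hfi := h.isFiniteMeasure i
  have hfj := h.isFiniteMeasure j
  have hne : i ≠ j := fun e => hij.ne (congrArg x e)
  have := nullSingletonClass_of_le_volume (h.piece_le i)
  have := nullSingletonClass_of_le_volume (h.piece_le j)
  set κ := s i + s j
  have hna : NullSingletonClass κ := ⟨fun y => by simp [κ]⟩
  have hm0 : (N : ℝ≥0∞)⁻¹ ≠ 0 := by simp
  have hmtop : (N : ℝ≥0∞)⁻¹ ≠ ∞ := h.mass i ▸ measure_ne_top _ _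
  obtain ⟨t₀, ht₀⟩ : ∃ t, κ (Iic t) ≤ (N : ℝ≥0∞)⁻¹ := by
    have : Filter.Tendsto (fun t => κ (Iic t)) Filter.atBot (nhds 0) := by
      have := tendsto_measure_iInter_atBot (μ := κ) (s := fun t : ℝ => Iic t)
        (fun _ => measurableSet_Iic.nullMeasurableSet) (fun _ _ h => Iic_subset_Iic.2 h)
        ⟨0, measure_ne_top _ _⟩
      rwa [iInter_Iic_eq_empty_iff.2 (by simp [not_bddBelow_univ]), measure_empty] at this
    exact ((this.eventually_lt_const (pos_iff_ne_zero.2 hm0)).exists).imp fun _ => le_of_lt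
  obtain ⟨t₁, ht₁⟩ : ∃ t, (N : ℝ≥0∞)⁻¹ ≤ κ (Iic t) := by
    have := tendsto_measure_Iic_atTop κ
    refine ((this.eventually_const_lt (u := (N : ℝ≥0∞)⁻¹) ?_).exists).imp fun _ => le_of_lt
    rw [Measure.add_apply, h.mass, h.mass]
    exact ENNReal.lt_add_right hmtop hm0
  obtain ⟨t, ht⟩ := exists_measure_Iic_eq κ ht₀ ht₁ (measure_ne_top _ _)
  have htc : κ (Iic t)ᶜ = (N : ℝ≥0∞)⁻¹ := by
    have := measure_add_measure_compl (μ := κ) (measurableSet_Iic (a := t))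
    rw [ht, Measure.add_apply _ _ univ, h.mass, h.mass] at this
    exact (ENNReal.add_right_inj hmtop).1 this
  refine ⟨t, ?_⟩
  have hκi : ∀ z, Integrable (fun y => (y - z) ^ 2) κ := fun z =>
    (h.integrable i z).add_measure (h.integrable j z)
  -- The competitor cuts the joint mass of both cells at its median `t`, the left half going to the
  -- left particle.
  set r : Fin N → Measure ℝ := fun k =>
    if k = i then κ.restrict (Iic t) else if k = j then κ.restrict (Iic t)ᶜ else s k
  have hri : r i = κ.restrict (Iic t) := by simp [r]
  have hrj : r j = κ.restrict (Iic t)ᶜ := by simp [r, hne.symm]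
  have hrk : ∀ k, k ≠ i → k ≠ j → r k = s k := fun k hi hj => by simp [r, hi, hj]
  have hcases : ∀ p : Fin N → Measure ℝ → Prop, p i (κ.restrict (Iic t)) →
      p j (κ.restrict (Iic t)ᶜ) → (∀ k, p k (s k)) → ∀ k, p k (r k) := fun p h1 h2 h3 k => by
    by_cases hki : k = i
    · subst hki; rwa [hri]
    by_cases hkj : k = j
    · subst hkj; rwa [hrj]
    rw [hrk k hki hkj]; exact h3 k
  have hnull : κ Ωᶜ = 0 := by simp [κ, h.null]
  have hpart : IsPartition Ω r := by
    refine ⟨hcases (fun _ q => q univ = _) ?_ ?_ h.mass,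
      hcases (fun _ q => q Ωᶜ = 0) ?_ ?_ h.null, ?_⟩
    · simpa using ht
    · simpa using htc
    · exact Measure.absolutelyContinuous_of_le Measure.restrict_le_self hnull
    · exact Measure.absolutelyContinuous_of_le Measure.restrict_le_self hnull
    · refine le_of_eq_of_le ?_ h.le_volume
      rw [sum_eq_add_add hne, sum_eq_add_add hne, hri, hrj, ← add_assoc, ← add_assoc,
        Measure.restrict_add_restrict_compl measurableSet_Iic]
      congr 1
      refine Finset.sum_congr rfl fun k hk => hrk k ?_ ?_ <;> simp_all
  have hopt := h.le r hpart
    (hcases (fun k q => Integrable (fun y => (y - x k) ^ 2) q) (hκi _).integrableOn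
      (hκi _).integrableOn fun k => h.integrable k _)
  rw [sum_eq_add_add hne, sum_eq_add_add hne, hri, hrj] at hopt
  have hrest : ∑ k ∈ (Finset.univ.erase i).erase j, ∫ y, (y - x k) ^ 2 ∂(r k) =
      ∑ k ∈ (Finset.univ.erase i).erase j, ∫ y, (y - x k) ^ 2 ∂(s k) :=
    Finset.sum_congr rfl fun k hk => by rw [hrk k] <;> simp_all
  rw [hrest] at hopt
  have hsplit := integral_add_compl (measurableSet_Iic (a := t)) (hκi (x j))
  rw [integral_add_measure (h.integrable i _) (h.integrable j _)] at hsplit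
  have hfint : ∀ k, Integrable (fun y => (y - x i) ^ 2 - (y - x j) ^ 2) (s k) := fun k =>
    (h.integrable k _).sub (h.integrable k _)
  -- This `f` is affine with slope `2 * (x j - x i) > 0`, so its sublevel sets are half-lines.
  refine bathtub (s i) (s j) (f := fun y => (y - x i) ^ 2 - (y - x j) ^ 2)
    (t := (t - x i) ^ 2 - (t - x j) ^ 2) measurableSet_Iic ?_ ?_ ?_ (hfint i)
    (hfint j).integrableOn ?_
  · intro y hy
    nlinarith [mem_Iic.1 hy]
  · intro y hy
    have : t < y := by simpa using hy
    nlinarith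
  · rw [← Measure.add_apply, h.mass]
    exact ht
  · have e1 : ∫ y in Iic t, ((y - x i) ^ 2 - (y - x j) ^ 2) ∂(s i) +
        ∫ y in Iic t, ((y - x i) ^ 2 - (y - x j) ^ 2) ∂(s j) =
        ∫ y in Iic t, (y - x i) ^ 2 ∂κ - ∫ y in Iic t, (y - x j) ^ 2 ∂κ := by
      rw [← integral_sub (hκi _).integrableOn (hκi _).integrableOn, Measure.restrict_add,
        integral_add_measure (hfint i).integrableOn (hfint j).integrableOn]
    rw [e1, integral_sub (h.integrable i _) (h.integrable i _)]
    linarith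

/-- A cell saturates the constraint within the ball that it occupies. -/
lemma IsOptimalPartition.saturated (h : IsOptimalPartition Ω x s) {v : Measure ℝ}
    (hv : v Ωᶜ = 0) (hsum : ∑ k, s k + v ≤ volume) (i : Fin N) :
    ∃ B : Set ℝ, B.OrdConnected ∧ s i Bᶜ = 0 ∧ v B = 0 := by
  rcases eq_or_ne v 0 with rfl | hv0
  · exact ⟨univ, ordConnected_univ, by simp, by simp⟩
  have hfi := h.isFiniteMeasure i
  have hvle : v ≤ volume := (le_add_of_nonneg_left (Measure.zero_le _)).trans hsum
  have := nullSingletonClass_of_le_volume (h.piece_le i)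
  have := nullSingletonClass_of_le_volume hvle
  have hmtop : (N : ℝ≥0∞)⁻¹ ≠ ∞ := h.mass i ▸ measure_ne_top _ _
  have hmd : Measurable fun y => dist y (x i) := by fun_prop
  set κ := s i + v
  have hpre : ∀ t, (fun y => dist y (x i)) ⁻¹' Iic t = Metric.closedBall (x i) t := fun t => rfl
  have hval : ∀ t, κ.map (fun y => dist y (x i)) (Iic t) = κ (Metric.closedBall (x i) t) :=
    fun t => by rw [Measure.map_apply hmd measurableSet_Iic, hpre]
  have hvfin : ∀ t, v (Metric.closedBall (x i) t) ≠ ∞ := fun t =>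
    ne_top_of_le_ne_top measure_closedBall_lt_top.ne (hvle _)
  have hκfin : ∀ t, κ (Metric.closedBall (x i) t) ≠ ∞ := fun t => by
    rw [Measure.add_apply]
    exact ENNReal.add_ne_top.2 ⟨measure_ne_top _ _, hvfin t⟩
  -- Pushing forward by the distance to `x i` turns balls into half-lines; a sphere has at most two
  -- points, so no atom appears.
  have hna : NullSingletonClass (κ.map fun y => dist y (x i)) := ⟨fun t => by
    rw [Measure.map_apply hmd (measurableSet_singleton t)]
    have hfin : ((fun y => dist y (x i)) ⁻¹' {t}).Finite := by
      refine (Set.toFinite {x i - t, x i + t}).subset fun y hy => ?_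
      have hy : |y - x i| = t := hy
      rcases abs_cases (y - x i) with h | h
      · right; simp only [mem_singleton_iff]; linarith
      · left; linarith
    simp [κ, hfin.measure_zero]⟩
  obtain ⟨t₁, ht₁⟩ : ∃ t, (N : ℝ≥0∞)⁻¹ ≤ κ (Metric.closedBall (x i) t) := by
    have hmono : Monotone fun n : ℕ => Metric.closedBall (x i) (n : ℝ) := fun a b hab =>
      Metric.closedBall_subset_closedBall (by exact_mod_cast hab)
    have := tendsto_measure_iUnion_atTop (μ := κ) hmono
    rw [Metric.iUnion_closedBall_nat] at this
    obtain ⟨n, hn⟩ := (this.eventually_const_lt (u := (N : ℝ≥0∞)⁻¹) (by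
      rw [Measure.add_apply, h.mass]
      exact ENNReal.lt_add_right hmtop (by simpa using hv0))).exists
    exact ⟨n, hn.le⟩
  obtain ⟨t, ht⟩ := exists_measure_Iic_eq (κ.map fun y => dist y (x i)) (t₀ := -1) (t₁ := t₁)
    (m := (N : ℝ≥0∞)⁻¹) (by rw [hval]; simp) (by rwa [hval]) (by rw [hval]; exact hκfin _)
  rw [hval] at ht
  have hi0 : (N : ℝ≥0∞)⁻¹ ≠ 0 := by simp
  have ht0 : 0 ≤ t := by
    by_contra hlt
    rw [Metric.closedBall_eq_empty.2 (not_le.1 hlt), measure_empty] at ht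
    exact hi0 ht.symm
  set B := Metric.closedBall (x i) t
  have hB : MeasurableSet B := Metric.isClosed_closedBall.measurableSet
  have hBv : IntegrableOn (fun y => (y - x i) ^ 2) B v := by
    have hc : IntegrableOn (fun y => (y - x i) ^ 2) B volume :=
      (by fun_prop : Continuous fun y => (y - x i) ^ 2).continuousOn.integrableOn_compact
        (isCompact_closedBall _ _)
    exact hc.mono_measure hvle
  have hBκ : IntegrableOn (fun y => (y - x i) ^ 2) B κ :=
    integrableOn_add_measure.2 ⟨(h.integrable i _).integrableOn, hBv⟩
  have hupd : ∀ k, k ≠ i → Function.update s i (κ.restrict B) k = s k := fun k hk =>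
    Function.update_of_ne hk _ _
  -- The competitor refills the `i`-th piece with all mass of `s i + v` in the ball of `κ`-mass
  -- `1/N`.
  have hpart : IsPartition Ω (Function.update s i (κ.restrict B)) := by
    refine ⟨fun k => ?_, fun k => ?_, ?_⟩
    · rcases eq_or_ne k i with rfl | hk
      · simpa using ht
      · rw [hupd k hk, h.mass]
    · rcases eq_or_ne k i with rfl | hk
      · rw [Function.update_self]
        refine Measure.absolutelyContinuous_of_le Measure.restrict_le_self ?_
        simp [κ, hv, h.null]
      · rw [hupd k hk, h.null]
    · refine le_trans ?_ hsum
      rw [← Finset.add_sum_erase _ _ (Finset.mem_univ i),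
        ← Finset.add_sum_erase _ s (Finset.mem_univ i), Function.update_self,
        Finset.sum_congr rfl fun k hk => hupd k (Finset.ne_of_mem_erase hk), add_right_comm]
      gcongr
      exact Measure.restrict_le_self
  have hopt := h.le _ hpart fun k => by
    rcases eq_or_ne k i with rfl | hk
    · rwa [Function.update_self]
    · rw [hupd k hk]; exact h.integrable k _
  rw [← Finset.add_sum_erase _ _ (Finset.mem_univ i),
    ← Finset.add_sum_erase _ (fun k => ∫ y, (y - x k) ^ 2 ∂(Function.update s i (κ.restrict B) k))
      (Finset.mem_univ i), Function.update_self,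
    Finset.sum_congr rfl fun k hk => by rw [← hupd k (Finset.ne_of_mem_erase hk)]] at hopt
  replace hopt := le_of_add_le_add_right hopt
  rw [Measure.restrict_add, integral_add_measure (h.integrable i _).integrableOn hBv] at hopt
  have hBd : ∀ y, y ∈ B ↔ |y - x i| ≤ t := fun y => Iff.rfl
  refine ⟨B, (convex_closedBall _ _).ordConnected, ?_⟩
  refine bathtub (s i) v (f := fun y => (y - x i) ^ 2) (t := t ^ 2) hB ?_ ?_ ?_
    (h.integrable i _) hBv hopt
  · intro y hy
    rw [← sq_abs]
    exact pow_le_pow_left₀ (abs_nonneg _) ((hBd y).1 hy) 2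
  · intro y hy
    have : t < |y - x i| := not_le.1 fun h => hy ((hBd y).2 h)
    rw [← sq_abs (y - x i)]
    exact pow_lt_pow_left₀ this ht0 two_ne_zero
  · rw [← Measure.add_apply, h.mass]
    exact ht

/-- The pieces of an optimal partition are Lebesgue measure on intervals. -/
lemma IsOptimalPartition.eq_restrict_Icc (h : IsOptimalPartition Ω x s) (hΩ : Ω.OrdConnected)
    (hx : Function.Injective x) (i : Fin N) :
    ∃ a b : ℝ, b - a = 1 / (N : ℝ) ∧ s i = volume.restrict (Icc a b) ∧
      ∀ j, j ≠ i → s j (Icc a b) = 0 := by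
  have hfin : IsFiniteMeasure (∑ k, s k) := ⟨by
    rw [Measure.finsetSum_apply]
    exact ENNReal.sum_lt_top.2 fun k _ => (h.isFiniteMeasure k).1⟩
  have hΩm : MeasurableSet Ω := hΩ.measurableSet
  have hsle : ∑ k, s k ≤ volume.restrict Ω := by
    have : (∑ k, s k).restrict Ω = ∑ k, s k := Measure.restrict_eq_self_of_ae_mem <| by
      rw [ae_iff]
      change (∑ k, s k) Ωᶜ = 0
      simp [Measure.finsetSum_apply, h.null]
    rw [← this]
    exact Measure.restrict_mono subset_rfl h.le_volume
  set v := volume.restrict Ω - ∑ k, s k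
  have hv : ∑ k, s k + v = volume.restrict Ω := by
    rw [add_comm]
    exact Measure.sub_add_cancel_of_le hsle
  have hvΩ : v Ωᶜ = 0 :=
    Measure.absolutelyContinuous_of_le Measure.sub_le (by simp [hΩm.compl])
  obtain ⟨B, hBo, hB1, hB2⟩ := h.saturated hvΩ (hv ▸ Measure.restrict_le_self) i
  -- The half-line on the side of `x i`; for `j = i` there is no constraint.
  have hsep : ∀ j, ∃ D : Set ℝ, D.OrdConnected ∧ s i Dᶜ = 0 ∧ (j ≠ i → s j D = 0) := fun j => by
    rcases lt_trichotomy (x i) (x j) with hij | hij | hij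
    · obtain ⟨t, h1, h2⟩ := h.separated hij
      exact ⟨Iic t, ordConnected_Iic, h1, fun _ => h2⟩
    · exact ⟨univ, ordConnected_univ, by simp, fun hne => absurd (hx hij).symm hne⟩
    · obtain ⟨t, h1, h2⟩ := h.separated hij
      exact ⟨(Iic t)ᶜ, by rw [compl_Iic]; exact ordConnected_Ioi, by rwa [compl_compl],
        fun _ => h1⟩
  choose D hDo hD1 hD2 using hsep
  set C := Ω ∩ (B ∩ ⋂ j, D j)
  have hCo : C.OrdConnected := hΩ.inter (hBo.inter (ordConnected_iInter hDo))
  have hCm : MeasurableSet C := hCo.measurableSet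
  have hCi : s i Cᶜ = 0 := by
    simp only [C, compl_inter, compl_iInter]
    exact measure_union_null (h.null i) (measure_union_null hB1 (measure_iUnion_null hD1))
  have hCj : ∀ j, j ≠ i → s j C = 0 := fun j hj =>
    measure_mono_null (fun y hy => mem_iInter.1 hy.2.2 j) (hD2 j hj)
  have hCv : v C = 0 := measure_mono_null (fun y hy => hy.2.1) hB2
  have hiC : s i = volume.restrict C := by
    have h1 : (volume.restrict Ω).restrict C = volume.restrict C := by
      rw [Measure.restrict_restrict hCm, inter_eq_left.2 inter_subset_left]
    rw [← h1, ← hv, Measure.restrict_add, Measure.restrict_eq_zero.2 hCv, add_zero,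
      ← Finset.add_sum_erase _ _ (Finset.mem_univ i), Measure.restrict_add,
      Measure.restrict_eq_self_of_ae_mem (s := C) (by rw [ae_iff]; exact hCi)]
    have : (∑ k ∈ Finset.univ.erase i, s k).restrict C = 0 := by
      rw [Measure.restrict_eq_zero, Measure.finsetSum_apply]
      exact Finset.sum_eq_zero fun k hk => hCj k (Finset.ne_of_mem_erase hk)
    rw [this, add_zero]
  have hN : (0 : ℝ) < N := by exact_mod_cast i.pos
  have hvol : volume C = ENNReal.ofReal (1 / (N : ℝ)) := by
    rw [← Measure.restrict_apply_univ C, ← hiC, h.mass, one_div, ENNReal.ofReal_inv_of_pos hN,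
      ENNReal.ofReal_natCast]
  obtain ⟨a, b, hab, hae⟩ := exists_Icc_of_ordConnected hCo (one_div_pos.2 hN) hvol
  refine ⟨a, b, hab, hiC.trans (Measure.restrict_congr_set hae), fun j hj => ?_⟩
  rw [← measure_congr ((Measure.absolutelyContinuous_of_le (h.piece_le j)).ae_eq hae)]
  exact hCj j hj

end Optimality

/-! ### Finiteness of the minimal cost -/

/-- An unbounded interval contains a unit interval; on a bounded one `σ` itself serves. -/
lemma exists_bounded_mem_K {Ω : Set ℝ} (hΩ : Ω.OrdConnected) {σ : Measure ℝ} (hσ : σ ∈ K Ω) :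
    ∃ ρ ∈ K Ω, ∃ R : ℝ, ρ (Metric.closedBall 0 R)ᶜ = 0 := by
  by_cases hb : Bornology.IsBounded Ω
  · obtain ⟨R, hR⟩ := hb.subset_closedBall 0
    exact ⟨σ, hσ, R, measure_mono_null (compl_subset_compl.2 hR) hσ.2.1⟩
  have hp : ∃ p, Icc p (p + 1) ⊆ Ω := by
    obtain ⟨p, hp⟩ : Ω.Nonempty := by
      by_contra h
      exact hb (not_nonempty_iff_eq_empty.1 h ▸ Bornology.isBounded_empty)
    by_contra! hno
    refine hb ((Metric.isBounded_Icc (p - 1) (p + 1)).subset fun q hq => ⟨?_, ?_⟩)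
    · by_contra! hlt
      exact hno (p - 1) ((Icc_subset_Icc hlt.le (by linarith)).trans (hΩ.out hq hp))
    · by_contra! hlt
      exact hno p ((Icc_subset_Icc le_rfl hlt.le).trans (hΩ.out hp hq))
  obtain ⟨p, hp⟩ := hp
  obtain ⟨R, hR⟩ := (Metric.isBounded_Icc p (p + 1)).subset_closedBall 0
  have hnull : volume.restrict (Icc p (p + 1)) (Icc p (p + 1))ᶜ = 0 := by
    rw [Measure.restrict_apply measurableSet_Icc.compl, compl_inter_self, measure_empty]
  exact ⟨volume.restrict (Icc p (p + 1)), ⟨⟨by simp⟩,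
    measure_mono_null (compl_subset_compl.2 hp) hnull, Measure.restrict_le_self⟩, R,
    measure_mono_null (compl_subset_compl.2 hR) hnull⟩

/-- The product coupling with a boundedly supported competitor has finite cost. This lets the
minimality be read on real integrals. -/
lemma W2_sq_projection_lt_top {Ω : Set ℝ} (hΩ : Ω.OrdConnected) {N : ℕ} (hN : 0 < N)
    {x : Fin N → ℝ} {σ : Measure ℝ} (hσ : IsProjection Ω (empirical x) σ) :
    W2 (empirical x) σ ^ 2 < ∞ := by
  obtain ⟨ρ, hρ, R, hR⟩ := exists_bounded_mem_K hΩ hσ.1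
  have := hρ.1
  refine (hσ.2 ρ hρ).trans_lt ((W2_sq_le_swap _ _).trans_lt ?_)
  have hsum : ∑ _k : Fin N, (N : ℝ≥0∞)⁻¹ • ρ = ρ := by
    rw [Finset.sum_const, Finset.card_univ, Fintype.card_fin, ← Nat.cast_smul_eq_nsmul ℝ≥0∞,
      smul_smul, ENNReal.mul_inv_cancel (by exact_mod_cast hN.ne') (ENNReal.natCast_ne_top N),
      one_smul]
  have hle := W2_sq_sum_le x (fun _ => (N : ℝ≥0∞)⁻¹ • ρ) fun _ => by simp
  rw [hsum] at hle
  refine hle.trans_lt (ENNReal.sum_lt_top.2 fun k _ => ?_)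
  rw [lintegral_smul_measure]
  refine ENNReal.mul_lt_top (by rw [ENNReal.inv_lt_top]; exact_mod_cast hN) ?_
  have hbd : ∀ᵐ y ∂ρ, edist y (x k) ^ 2 ≤ ENNReal.ofReal ((R + |x k|) ^ 2) := by
    have : ∀ᵐ y ∂ρ, y ∈ Metric.closedBall 0 R := by rw [ae_iff]; exact hR
    filter_upwards [this] with y hy
    rw [edist_sq_eq_ofReal, ← sq_abs]
    have hy : |y| ≤ R := by simpa using hy
    exact ENNReal.ofReal_le_ofReal (pow_le_pow_left₀ (abs_nonneg _)
      ((abs_sub _ _).trans (by linarith)) 2)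
  refine (lintegral_mono_ae hbd).trans_lt ?_
  simp

/-! ### The cells form an optimal partition -/

section Cells

variable {Ω : Set ℝ} {N : ℕ} {x : Fin N → ℝ} {σ : Measure ℝ} {T : ℝ → ℝ}

lemma measurableSet_cell (hΩ : Ω.OrdConnected) (hT : Measurable T) (i : Fin N) :
    MeasurableSet (cell Ω T x i) :=
  hΩ.measurableSet.inter (hT (measurableSet_singleton _))

lemma disjoint_cell (hx : Function.Injective x) :
    Pairwise (Function.onFun Disjoint (cell Ω T x)) := fun i _ hij =>
  disjoint_left.2 fun y hi hj => hij (hx ((show T y = x i from hi.2).symm.trans hj.2))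

lemma sum_restrict_cell (hΩ : Ω.OrdConnected) (hx : Function.Injective x) (hσ : σ Ωᶜ = 0)
    (hT : Measurable T) (hmap : σ.map T = empirical x) :
    ∑ k, σ.restrict (cell Ω T x k) = σ := by
  have hrange : σ (T ⁻¹' (range x)ᶜ) = 0 := by
    rw [← Measure.map_apply hT (finite_range x).measurableSet.compl, hmap, empirical]
    simp [Measure.finsetSum_apply]
  have hnull : σ (⋃ k, cell Ω T x k)ᶜ = 0 := by
    refine measure_mono_null (fun y hy => ?_) (measure_union_null hσ hrange)
    by_contra hcon
    simp only [mem_union, mem_compl_iff, mem_preimage, not_or, not_not] at hcon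
    obtain ⟨k, hk⟩ := hcon.2
    exact hy (mem_iUnion.2 ⟨k, hcon.1, hk.symm⟩)
  calc ∑ k, σ.restrict (cell Ω T x k) = σ.restrict (⋃ k, cell Ω T x k) := by
        rw [Measure.restrict_iUnion (disjoint_cell hx) (measurableSet_cell hΩ hT),
          Measure.sum_fintype]
    _ = σ := Measure.restrict_eq_self_of_ae_mem (by rw [ae_iff]; exact hnull)

lemma measure_cell (hx : Function.Injective x) (hσ : σ Ωᶜ = 0)
    (hT : Measurable T) (hmap : σ.map T = empirical x) (i : Fin N) :
    σ (cell Ω T x i) = (N : ℝ≥0∞)⁻¹ := by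
  have h : σ (T ⁻¹' {x i}) = (N : ℝ≥0∞)⁻¹ := by
    rw [← Measure.map_apply hT (measurableSet_singleton _), hmap, empirical]
    simp [Measure.finsetSum_apply, Set.indicator_apply, hx.eq_iff]
  rw [cell, Measure.measure_inter_eq_of_ae (by rw [ae_iff]; exact hσ), h]

lemma isOptimalPartition_cells (hΩ : Ω.OrdConnected) (hN : 0 < N) (hx : Function.Injective x)
    (hσ : IsProjection Ω (empirical x) σ) (hT : IsOptimalMap σ (empirical x) T) :
    IsOptimalPartition Ω x fun k => σ.restrict (cell Ω T x k) := by
  obtain ⟨hTm, hmap, hcost⟩ := hT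
  have hσΩ := hσ.1.2.1
  have := hσ.1.1
  have hsum := sum_restrict_cell hΩ hx hσΩ hTm hmap
  have htotal : ∑ k, ∫⁻ y in cell Ω T x k, edist y (x k) ^ 2 ∂σ = W2 σ (empirical x) ^ 2 := by
    rw [← hcost]
    conv_rhs => rw [← hsum, lintegral_finsetSum_measure]
    refine Finset.sum_congr rfl fun k _ => setLIntegral_congr_fun (measurableSet_cell hΩ hTm k) ?_
    intro y hy
    simp only [show T y = x k from hy.2]
  have hfin : ∑ k, ∫⁻ y in cell Ω T x k, edist y (x k) ^ 2 ∂σ < ∞ := by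
    rw [htotal]
    exact (W2_sq_le_swap _ _).trans_lt (W2_sq_projection_lt_top hΩ hN hσ)
  have hint : ∀ k, Integrable (fun y => (y - x k) ^ 2) (σ.restrict (cell Ω T x k)) := fun k => by
    refine ⟨by fun_prop, ?_⟩
    rw [hasFiniteIntegral_iff_ofReal (ae_of_all _ fun y => sq_nonneg _)]
    simp_rw [← edist_sq_eq_ofReal]
    exact ENNReal.sum_lt_top.1 hfin k (Finset.mem_univ k)
  have hreal : ∀ r : Fin N → Measure ℝ, (∀ k, Integrable (fun y => (y - x k) ^ 2) (r k)) →
      ∑ k, ∫⁻ y, edist y (x k) ^ 2 ∂(r k) = ENNReal.ofReal (∑ k, ∫ y, (y - x k) ^ 2 ∂(r k)) :=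
    fun r hr => by
      rw [ENNReal.ofReal_sum_of_nonneg fun k _ => integral_nonneg fun y => sq_nonneg _]
      refine Finset.sum_congr rfl fun k _ => ?_
      rw [ofReal_integral_eq_lintegral_ofReal (hr k) (ae_of_all _ fun y => sq_nonneg _)]
      simp_rw [edist_sq_eq_ofReal]
  refine ⟨⟨fun k => ?_, fun k => ?_, ?_⟩, fun k z => ?_, fun r hr hri => ?_⟩
  · rw [Measure.restrict_apply_univ, measure_cell hx hσΩ hTm hmap]
  · exact Measure.absolutelyContinuous_of_le Measure.restrict_le_self hσΩ
  · rw [hsum]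
    exact hσ.1.2.2
  -- Square integrability about `x k` passes to any centre `z`, as constants are in `L²`.
  · have h2 := (memLp_two_iff_integrable_sq (by fun_prop)).2 (hint k)
    have h3 := (h2.add (memLp_const (x k - z))).integrable_sq
    refine h3.congr (ae_of_all _ fun y => ?_)
    simp only [Pi.add_apply]
    ring
  · have hrK : ∑ k, r k ∈ K Ω := by
      refine ⟨⟨?_⟩, ?_, hr.le_volume⟩
      · simp only [Measure.finsetSum_apply, hr.mass, Finset.sum_const, Finset.card_univ,
          Fintype.card_fin, nsmul_eq_mul]
        exact ENNReal.mul_inv_cancel (by exact_mod_cast hN.ne') (ENNReal.natCast_ne_top N)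
      · simp [Measure.finsetSum_apply, hr.null]
    have key : ∑ k, ∫⁻ y in cell Ω T x k, edist y (x k) ^ 2 ∂σ ≤
        ∑ k, ∫⁻ y, edist y (x k) ^ 2 ∂(r k) := by
      rw [htotal]
      exact (W2_sq_le_swap _ _).trans ((hσ.2 _ hrK).trans ((W2_sq_le_swap _ _).trans
        (W2_sq_sum_le x r hr.mass)))
    rw [hreal _ hint, hreal r hri] at key
    exact (ENNReal.ofReal_le_ofReal_iff
      (Finset.sum_nonneg fun k _ => integral_nonneg fun y => sq_nonneg _)).1 key

end Cells

end CrowdMotion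

/-! ### Conclusion -/

theorem proposition4p1 (Ω : Set ℝ) (hΩ : Ω.OrdConnected) (N : ℕ) (hN : 0 < N)
    (x : Fin N → ℝ) (hx : Function.Injective x) (σ : Measure ℝ)
    (hσ : CrowdMotion.IsProjection Ω (CrowdMotion.empirical x) σ) (T : ℝ → ℝ)
    (hT : CrowdMotion.IsOptimalMap σ (CrowdMotion.empirical x) T)
    (ε : ℝ) (hε : ε = 1 / (N : ℝ)) :
    (∀ i, ∃ a b : ℝ, b - a = 1 / (N : ℝ) ∧
      CrowdMotion.cell Ω T x i =ᵐ[σ] Icc a b ∧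
      σ.restrict (CrowdMotion.cell Ω T x i) = volume.restrict (Icc a b) ∧
      CrowdMotion.bary Ω σ T x i = (a + b) / 2) ∧
    ENNReal.ofReal (1 / ε ^ 2) *
      CrowdMotion.W2 σ (CrowdMotion.empirical (CrowdMotion.bary Ω σ T x)) ^ 2 ≤
        ENNReal.ofReal (1 / 12) := by
  open CrowdMotion in
  have hopt := isOptimalPartition_cells hΩ hN hx hσ hT
  have hsum := sum_restrict_cell hΩ hx hσ.1.2.1 hT.1 hT.2.1
  have hNR : (0 : ℝ) < N := by exact_mod_cast hN
  have hcells : ∀ i, ∃ a b : ℝ, b - a = 1 / (N : ℝ) ∧ cell Ω T x i =ᵐ[σ] Icc a b ∧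
      σ.restrict (cell Ω T x i) = volume.restrict (Icc a b) ∧
      bary Ω σ T x i = (a + b) / 2 := fun i => by
    obtain ⟨a, b, hab, heq, hdisj⟩ := hopt.eq_restrict_Icc hΩ hx i
    have hle : a ≤ b := by
      have := one_div_pos.2 hNR
      linarith
    refine ⟨a, b, hab, ?_, heq, ?_⟩
    · have hL := measurableSet_cell (x := x) hΩ hT.1 i
      refine Filter.EventuallyLE.antisymm ?_ ?_
      · refine (ae_le_set (μ := σ)).2 ?_
        have := congrArg (fun m : Measure ℝ => m (Icc a b)ᶜ) heq
        simp only [Measure.restrict_apply measurableSet_Icc.compl, compl_inter_self,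
          measure_empty] at this
        rwa [sdiff_eq, inter_comm]
      · refine (ae_le_set (μ := σ)).2 ?_
        -- Piece `i` has no mass outside its cell, and the other pieces have none on `Icc a b`.
        rw [← hsum, Measure.finsetSum_apply]
        refine Finset.sum_eq_zero fun k _ => ?_
        rcases eq_or_ne k i with rfl | hk
        · rw [Measure.restrict_apply (measurableSet_Icc.diff hL), sdiff_inter_self, measure_empty]
        · exact measure_mono_null sdiff_subset (hdisj k hk)
    · rw [bary, heq, integral_Icc_eq_integral_Ioc, ← intervalIntegral.integral_of_le hle,
        integral_id]
      have : (N : ℝ) * (b - a) = 1 := by rw [hab]; field_simp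
      linear_combination (a + b) / 2 * this
  refine ⟨hcells, ?_⟩
  -- Second moment of an interval of length `1/N` about its midpoint.
  have hcost : ∀ k, ∫⁻ y in cell Ω T x k, edist y (bary Ω σ T x k) ^ 2 ∂σ =
      ENNReal.ofReal ((1 / (N : ℝ)) ^ 3 / 12) := fun k => by
    obtain ⟨a, b, hab, -, heq, hbary⟩ := hcells k
    have hle : a ≤ b := by
      have := one_div_pos.2 hNR
      linarith
    have hi : Integrable (fun y => (y - (a + b) / 2) ^ 2) (volume.restrict (Icc a b)) :=
      (by fun_prop : Continuous fun y : ℝ => (y - (a + b) / 2) ^ 2).integrableOn_Icc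
    rw [heq, hbary]
    simp_rw [edist_sq_eq_ofReal]
    rw [← ofReal_integral_eq_lintegral_ofReal hi (ae_of_all _ fun y => sq_nonneg _),
      integral_Icc_eq_integral_Ioc, ← intervalIntegral.integral_of_le hle,
      intervalIntegral.integral_comp_sub_right (fun y => y ^ 2), integral_pow, ← hab]
    congr 1
    push_cast
    ring
  have hW := W2_sq_sum_le (bary Ω σ T x) _ hopt.mass
  rw [hsum, Finset.sum_congr rfl fun k _ => hcost k, Finset.sum_const, Finset.card_univ,
    Fintype.card_fin, nsmul_eq_mul, ← ENNReal.ofReal_natCast,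
    ← ENNReal.ofReal_mul hNR.le] at hW
  refine (mul_le_mul_right hW _).trans (le_of_eq ?_)
  rw [← ENNReal.ofReal_mul (by positivity), hε]
  congr 1
  field_simp
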